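/- Fix $1<p<\infty$ and $1/p+1/p'=1$. A rooted tree $T$ is a locally finite tree with a root vertex $o$ that has exactly one edge, the root edge $\omega$; $E(T)$ is its edge set. To superimpose trees, all rooted trees are regarded as subtrees, with the common root edge $\omega=\emptyset$, of the universal tree whose edges are the finite words over $\mathbb{N}$, the edges following $x$ being the words $xa$, $a\in\mathbb{N}$. The boundary $\partial T$ is the set of half-infinite geodesics starting at the root together with the leaves of $T$; for $\zeta\in\partial T$, $P(\zeta)$ is the set of edges of the geodesic from $o$ to $\zeta$. For $\alpha\in E(T)$ put $\partial T_\alpha=\{\zeta\in\partial T:\alpha\in P(\zeta)\}$; these sets form a basis of the topology of $\partial T$. For $f:E(T)\to[0,\infty)$ put $If(\zeta)=\sum_{\alpha\in P(\zeta)}f(\alpha)$, and for $A\subseteq\partial T$ put $\Omega_A=\{f\in\ell^p(E(T)): f\ge 0,\ If\ge 1\text{ on }A\}$ and $c_p(A)=\inf_{f\in\Omega_A}\|f\|_{\ell^p}^p$. The equilibrium measure of $\partial T$ is the finite positive Borel measure $\mu$ on $\partial T$ with $\mu(\partial T)=c_p(\partial T)$ for which the function $M_p(\alpha)=\mu(\partial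 T_\alpha)^{p'-1}$ lies in the $\ell^p$-closure of $\Omega_{\partial T}$ and satisfies $\|M_p\|_{\ell^p}^p=c_p(\partial T)$. A point $\zeta\in\partial T$ is $p$-irregular if $IM_p(\zeta)<1$, and $\partial T$ is regular if it has no $p$-irregular points. The biggest common subtree $\langle T,R\rangle$ has edge set $E(T)\cap E(R)$. **Theorem (Approximation of capacity via regular boundaries).** Let $T$ be a rooted tree with $c_p(\partial T)>0$. Then there is a rooted tree $R$ with regular boundary such that $$c_p(\partial R)=c_p(\partial T).$$ Moreover, for every $\varepsilon>0$ such an $R$ can be chosen so that $$c_p(\partial\langle T,R\rangle)\ge c_p(\partial T)-\varepsilon .$$ This holds even if edges that are leaves of $\langle T,R\rangle$ only because the edges after them were erased are not counted as boundary points, that is, with $\partial\langle T,R\rangle$ replaced by its subset $\partial T\cap\partial R$ of the points of $\partial\langle T,R\rangle$ that are boundary points of both $T$ and $R$. -/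

import Mathlib

open scoped ENNReal NNReal
open MeasureTheory

noncomputable section

/-- A locally finite rooted tree having one root edge `ω`, given by its edges inside the universal
tree of all finite words over `ℕ`: the empty word is `ω`, and the edges that follow the edge `x`
(that depart from its end vertex) are the words `x ++ [a]` of the tree.  The vertices other than
the root vertex `o` are the end vertices of the edges. -/
structure LocallyFiniteTree where
  carrier : Descriptive.tree ℕ
  root_mem : [] ∈ carrier
  finite_children : ∀ x ∈ carrier, {a : ℕ | x ++ [a] ∈ carrier}.Finite

namespace LocallyFiniteTree

/-- The edge set `E(T)`. -/
def Edge (T : LocallyFiniteTree) : Type := {x : List ℕ // x ∈ T.carrier}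

/-- A leaf is an edge with no edge after it. -/
def IsLeaf (T : LocallyFiniteTree) (x : List ℕ) : Prop :=
  x ∈ T.carrier ∧ ∀ a : ℕ, x ++ [a] ∉ T.carrier

/-- `P` is the set of edges of a half infinite geodesic that starts with the root edge. -/
def IsRay (T : LocallyFiniteTree) (P : Set (List ℕ)) : Prop :=
  ∃ s : ℕ → List ℕ, s 0 = [] ∧ (∀ n, ∃ a : ℕ, s (n + 1) = s n ++ [a]) ∧
    (∀ n, s n ∈ T.carrier) ∧ P = Set.range s

/-- `P` is the set of edges of the geodesic from the root to a leaf (the leaf included). -/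
def IsLeafPath (T : LocallyFiniteTree) (P : Set (List ℕ)) : Prop :=
  ∃ x, T.IsLeaf x ∧ P = {y | y <+: x}

/-- A boundary point is a half infinite geodesic from the root or a leaf; it is represented by its
predecessor set, the set of the edges on the geodesic from the root to it. -/
def IsBoundaryPoint (T : LocallyFiniteTree) (P : Set (List ℕ)) : Prop :=
  T.IsRay P ∨ T.IsLeafPath P

/-- The boundary `∂T`. -/
def Boundary (T : LocallyFiniteTree) : Type := {P : Set (List ℕ) // T.IsBoundaryPoint P}

/-- The boundary `∂T_α` of the tent rooted in the edge `α`, as a subset of `∂T`. -/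
def tentBoundary (T : LocallyFiniteTree) (α : T.Edge) : Set T.Boundary := {ζ | α.1 ∈ ζ.1}

/-- The topology of `∂T` is generated by the boundaries of tents. -/
instance (T : LocallyFiniteTree) : TopologicalSpace T.Boundary :=
  TopologicalSpace.generateFrom (Set.range T.tentBoundary)

instance (T : LocallyFiniteTree) : MeasurableSpace T.Boundary := borel T.Boundary

instance (T : LocallyFiniteTree) : BorelSpace T.Boundary := ⟨rfl⟩

/-- The potential `I f (ζ) = ∑_{α ∈ P(ζ)} f(α)`. -/
def potential (T : LocallyFiniteTree) (f : T.Edge → ℝ≥0) (ζ : T.Boundary) : ℝ≥0∞ :=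
  ∑' α : {α : T.Edge // α.1 ∈ ζ.1}, (f α.1 : ℝ≥0∞)

/-- `‖f‖_p^p`, the norm being that of `ℓ^p(E(T))`. -/
def normPow (T : LocallyFiniteTree) (p : ℝ) (f : T.Edge → ℝ≥0) : ℝ≥0∞ :=
  ∑' α : T.Edge, (f α : ℝ≥0∞) ^ p

/-- `Ω_E`: the nonnegative functions in `ℓ^p` with `I f ≥ 1` on `E`. -/
def testFunctions (T : LocallyFiniteTree) (p : ℝ) (E : Set T.Boundary) : Set (T.Edge → ℝ≥0) :=
  {f | T.normPow p f < ∞ ∧ ∀ ζ ∈ E, 1 ≤ T.potential f ζ}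

/-- The `p`-capacity `c_p(E)` of `E ⊆ ∂T`. -/
def capacity (T : LocallyFiniteTree) (p : ℝ) (E : Set T.Boundary) : ℝ≥0∞ :=
  ⨅ f ∈ T.testFunctions p E, T.normPow p f

/-- The capacity `c_p(∂T)` of the whole boundary. -/
def boundaryCapacity (T : LocallyFiniteTree) (p : ℝ) : ℝ≥0∞ := T.capacity p Set.univ

/-- `f` is admissible for `E`: it lies in the `ℓ^p`-closure of `Ω_E`. -/
def IsAdmissible (T : LocallyFiniteTree) (p : ℝ) (E : Set T.Boundary) (f : T.Edge → ℝ≥0) : Prop :=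
  ∀ δ : ℝ≥0∞, 0 < δ → ∃ g ∈ T.testFunctions p E, ∑' α : T.Edge, edist (f α) (g α) ^ p < δ

/-- `f` is the `p`-equilibrium function of `E`: admissible, with `‖f‖_p^p = c_p(E)`. -/
def IsEquilibriumFunction (T : LocallyFiniteTree) (p : ℝ) (E : Set T.Boundary)
    (f : T.Edge → ℝ≥0) : Prop :=
  T.IsAdmissible p E f ∧ T.normPow p f = T.capacity p E

/-- For a finite measure `μ` on `∂T` with co-potential `M(α) = μ(∂T_α)`, this is the edge function
`M_p = M ^ (p' - 1)`, where `1/p + 1/p' = 1`. -/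
def copotentialPow (T : LocallyFiniteTree) (p : ℝ) (μ : Measure T.Boundary) (α : T.Edge) : ℝ≥0 :=
  (μ (T.tentBoundary α)).toNNReal ^ (p.conjExponent - 1)

/-- `μ` is the `p`-equilibrium measure of `E`: a finite positive Borel measure carried by the
closure of `E`, of total mass `c_p(E)`, such that `M_p` is the `p`-equilibrium function of `E`. -/
structure IsEquilibriumMeasure (T : LocallyFiniteTree) (p : ℝ) (E : Set T.Boundary)
    (μ : Measure T.Boundary) : Prop where
  finite : IsFiniteMeasure μ
  carried : μ (closure E)ᶜ = 0
  equilibrium : T.IsEquilibriumFunction p E (T.copotentialPow p μ)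
  mass : μ (closure E) = T.capacity p E

/-- The irregular points `{ζ ∈ E : I M_p (ζ) < 1}`, for `μ` the equilibrium measure of `E`. -/
def irregularPoints (T : LocallyFiniteTree) (p : ℝ) (E : Set T.Boundary) (μ : Measure T.Boundary) :
    Set T.Boundary :=
  {ζ | ζ ∈ E ∧ T.potential (T.copotentialPow p μ) ζ < 1}

/-- `∂T` is regular: its equilibrium measure has no irregular points. -/
def HasRegularBoundary (T : LocallyFiniteTree) (p : ℝ) : Prop :=
  ∃ μ : Measure T.Boundary, T.IsEquilibriumMeasure p Set.univ μ ∧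
    T.irregularPoints p Set.univ μ = ∅

/-- The biggest common subtree `⟨T, R⟩`: an edge is kept when it and all the edges before it belong
to both trees. -/
def commonSubtree (T R : LocallyFiniteTree) : LocallyFiniteTree where
  carrier := T.carrier ⊓ R.carrier
  root_mem := ⟨T.root_mem, R.root_mem⟩
  finite_children := fun x hx => (T.finite_children x hx.1).subset fun _ ha => ha.1

/-- The boundary points of `⟨T, R⟩` that are boundary points of both `T` and `R`.  This is
`∂⟨T, R⟩` without the edges that have become leaves only because the edges after them were
erased. -/
def commonBoundary (T R : LocallyFiniteTree) : Set (T.commonSubtree R).Boundary :=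
  {ζ | T.IsBoundaryPoint ζ.1 ∧ R.IsBoundaryPoint ζ.1}

end LocallyFiniteTree

end

/-!
Suppose that a function `d` of the edges satisfies the recursion obeyed by the capacities of the
tents, and let `V x` be the part of the unit potential that is left before the edge `x` when the
equilibrium function of a tent of capacity `t` takes the value `t ^ (1 / (p - 1))` at its root edge,
relative to the potential left there. Then `V ^ (p - 1) * d` is additive along the tree, hence the
co-potential of a measure `μ` of mass `d ω`, and `M_p = V * d ^ (1 / (p - 1))` has `I M_p ≤ 1`
everywhere. Young's inequality gives `d ω ≤ c_p(∂T)`; if `I M_p = 1` everywhere, then equality holds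
and the boundary is regular.

The capacities of the tents, obtained as limits from truncated trees, satisfy `d ω = c_p(∂T)`, so
that `I M_p = 1` holds `μ`-almost everywhere. Cover the irregular points and the tents of capacity
zero by an open set `U` of small measure, and replace what follows the root edge of each tent with
boundary inside `U` by a caterpillar of the same capacity: at each edge as many leaves as fit and
one further tent for the remainder. The recursion survives, and so do the boundary points outside
`U`, which carry all but a small part of the capacity by duality. Along an infinite caterpillar the
resistance `t ^ (-1 / (p - 1))` drops by one at every edge where it exceeds two. Thus it is at most
two infinitely often, each time `V` is at least halved, and `I M_p = 1` at the end.
-/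

open Filter Topology

section General

lemma le_of_le_div_add_div {p q : ℝ} (hpq : p.HolderConjugate q) {a c : ℝ≥0∞} (hc : c ≠ ∞)
    (h : c ≤ a / ENNReal.ofReal p + c / ENNReal.ofReal q) : c ≤ a := by
  have hp : ENNReal.ofReal p ≠ 0 := by simpa using hpq.pos
  have hq : ENNReal.ofReal q ≠ 0 := by simpa using hpq.symm.pos
  have hsplit : c / ENNReal.ofReal p + c / ENNReal.ofReal q = c := by
    rw [div_eq_mul_inv, div_eq_mul_inv, ← mul_add, hpq.inv_add_inv_ennreal, mul_one]
  have hdiv : c / ENNReal.ofReal p ≤ a / ENNReal.ofReal p :=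
    (ENNReal.add_le_add_iff_right (ENNReal.div_ne_top hc hq)).1 (hsplit.trans_le h)
  rwa [ENNReal.div_le_iff hp ENNReal.ofReal_ne_top,
    ENNReal.div_mul_cancel hp ENNReal.ofReal_ne_top] at hdiv

lemma tendsto_zero_of_frequently_succ_le_mul {V : ℕ → ℝ≥0} (hV : Antitone V) {c : ℝ≥0}
    (hc : c < 1) (h : ∃ᶠ n in atTop, V (n + 1) ≤ c * V n) : Tendsto V atTop (𝓝 0) := by
  have hlim := tendsto_atTop_ciInf hV (OrderBot.bddBelow _)
  have hle : (⨅ n, V n) ≤ c * ⨅ n, V n :=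
    le_of_tendsto_of_tendsto_of_frequently (hlim.comp (tendsto_add_atTop_nat 1))
      (hlim.const_mul c) h
  rwa [← le_zero_iff.1 (le_of_not_gt fun h0 => hle.not_gt (mul_lt_of_lt_one_left h0 hc))]

lemma frequently_le_of_succ_add_one_le {r : ℕ → ℝ≥0} {b : ℝ≥0}
    (h : ∀ᶠ n in atTop, b < r n → r (n + 1) + 1 ≤ r n) : ∃ᶠ n in atTop, r n ≤ b := by
  intro hlt
  obtain ⟨N, hN⟩ := eventually_atTop.1 (h.and hlt)
  have hdrop : ∀ k : ℕ, r (N + k) + k ≤ r N := fun k => by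
    induction k with
    | zero => simp
    | succ k ih =>
      obtain ⟨hstep, hbig⟩ := hN (N + k) (Nat.le_add_right N k)
      calc r (N + (k + 1)) + ↑(k + 1) = r (N + k + 1) + 1 + k := by push_cast; ring_nf
        _ ≤ r (N + k) + k := by gcongr; exact hstep (not_le.1 hbig)
        _ ≤ r N := ih
  obtain ⟨k, hk⟩ := exists_nat_gt (r N)
  exact hk.not_ge (le_add_self.trans (hdrop k))

lemma hasSum_min_one_sub (C : ℝ≥0) : HasSum (fun a : ℕ => min 1 (C - a)) C := by
  rw [NNReal.hasSum_iff_tendsto_nat]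
  have hsum : ∀ n : ℕ, ∑ a ∈ Finset.range n, min 1 (C - a) = min (n : ℝ≥0) C := fun n => by
    induction n with
    | zero => simp
    | succ n ih =>
      rw [Finset.sum_range_succ, ih, Nat.cast_succ]
      rcases le_total C n with h | h
      · rw [tsub_eq_zero_of_le h, min_eq_right h, min_eq_right (h.trans le_self_add)]
        simp
      · rw [min_eq_left h, ← min_add_add_left, add_tsub_cancel_of_le h]
  simp_rw [hsum]
  obtain ⟨N, hN⟩ := exists_nat_ge C
  refine tendsto_const_nhds.congr' ?_
  filter_upwards [eventually_ge_atTop N] with n hn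
  exact (min_eq_right (hN.trans (Nat.cast_le.2 hn))).symm

end General

namespace LocallyFiniteTree

noncomputable section

/-! ### Boundary points as maximal chains of edges -/

section Ray

variable {α : Type*} {s : ℕ → List α} (h0 : s 0 = []) (hs : ∀ n, ∃ a, s (n + 1) = s n ++ [a])
include hs

lemma prefix_of_le {m n : ℕ} (hmn : m ≤ n) : s m <+: s n := by
  induction n, hmn using Nat.le_induction with
  | base => exact List.prefix_rfl
  | succ n _ ih =>
    obtain ⟨a, ha⟩ := hs n
    exact ha ▸ ih.trans (List.prefix_append _ _)

include h0

lemma length_eq_index (n : ℕ) : (s n).length = n := by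
  induction n with
  | zero => simp [h0]
  | succ n ih => obtain ⟨a, ha⟩ := hs n; simp [ha, ih]

lemma eq_apply_length_of_prefix {x : List α} {n : ℕ} (hx : x <+: s n) : s x.length = x := by
  have hle : x.length ≤ n := by simpa [length_eq_index h0 hs] using hx.length_le
  have hlen := length_eq_index h0 hs x.length
  exact (List.prefix_of_prefix_length_le (prefix_of_le hs hle) hx hlen.le).eq_of_length hlen

end Ray

variable {T S : LocallyFiniteTree} {P : Set (List ℕ)}

/-- A set of edges of `T` that is a chain for the prefix order, closed under prefixes and maximal
with these properties. Rays and paths to leaves are both of this kind, which spares most arguments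
about boundary points a case distinction. -/
structure IsMaximalPath (T : LocallyFiniteTree) (P : Set (List ℕ)) : Prop where
  nil_mem : [] ∈ P
  mem_carrier : ∀ x ∈ P, x ∈ T.carrier
  mem_of_prefix : ∀ x y, y ∈ P → x <+: y → x ∈ P
  chain : ∀ x ∈ P, ∀ y ∈ P, x <+: y ∨ y <+: x
  exists_concat_mem : ∀ x ∈ P, ¬ T.IsLeaf x → ∃ a : ℕ, x ++ [a] ∈ P

lemma IsRay.isMaximalPath (h : T.IsRay P) : T.IsMaximalPath P := by
  obtain ⟨s, h0, hs, hT, rfl⟩ := h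
  refine ⟨⟨0, h0⟩, ?_, ?_, ?_, ?_⟩
  · rintro _ ⟨n, rfl⟩
    exact hT n
  · rintro x _ ⟨n, rfl⟩ hx
    exact ⟨_, eq_apply_length_of_prefix h0 hs hx⟩
  · rintro _ ⟨m, rfl⟩ _ ⟨n, rfl⟩
    exact (le_total m n).imp (prefix_of_le hs) (prefix_of_le hs)
  · rintro _ ⟨n, rfl⟩ -
    obtain ⟨a, ha⟩ := hs n
    exact ⟨a, n + 1, ha⟩

lemma IsLeafPath.isMaximalPath (h : T.IsLeafPath P) : T.IsMaximalPath P := by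
  obtain ⟨x, hx, rfl⟩ := h
  refine ⟨List.nil_prefix, fun y hy => Descriptive.Tree.mem_of_prefix hy hx.1,
    fun y z hz hy => hy.trans hz, fun y hy z hz => List.prefix_or_prefix_of_prefix hy hz, ?_⟩
  rintro y ⟨_ | ⟨a, z⟩, rfl⟩ hl
  · exact absurd hx (by rwa [List.append_nil])
  · exact ⟨a, z, by simp⟩

lemma IsMaximalPath.eq_of_isLeaf (h : T.IsMaximalPath P) {x : List ℕ} (hx : x ∈ P)
    (hl : T.IsLeaf x) : P = {y | y <+: x} := by
  refine Set.ext fun y => ⟨fun hy => ?_, fun hy => h.mem_of_prefix _ _ hx hy⟩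
  rcases h.chain y hy x hx with hyx | ⟨_ | ⟨a, z⟩, rfl⟩
  · exact hyx
  · simp
  · exact absurd (h.mem_carrier _ (h.mem_of_prefix _ _ hy ⟨z, by simp⟩)) (hl.2 a)

lemma IsMaximalPath.isRay (h : T.IsMaximalPath P) (hl : ∀ x ∈ P, ¬ T.IsLeaf x) : T.IsRay P := by
  choose! e he using fun x hx => h.exists_concat_mem x hx (hl x hx)
  let s : ℕ → List ℕ := fun n => Nat.rec [] (fun _ x => x ++ [e x]) n
  have hs : ∀ n, ∃ a, s (n + 1) = s n ++ [a] := fun n => ⟨e (s n), rfl⟩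
  have hP : ∀ n, s n ∈ P := fun n => by
    induction n with
    | zero => exact h.nil_mem
    | succ n ih => exact he _ ih
  refine ⟨s, rfl, hs, fun n => h.mem_carrier _ (hP n), Set.Subset.antisymm (fun x hx => ?_) ?_⟩
  · have hlen : (s x.length).length = x.length := length_eq_index rfl hs x.length
    refine ⟨x.length, ?_⟩
    rcases h.chain x hx _ (hP x.length) with hp | hp
    · exact (hp.eq_of_length hlen.symm).symm
    · exact hp.eq_of_length hlen
  · rintro _ ⟨n, rfl⟩
    exact hP n

lemma isBoundaryPoint_iff_isMaximalPath : T.IsBoundaryPoint P ↔ T.IsMaximalPath P := by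
  refine ⟨fun h => h.elim IsRay.isMaximalPath IsLeafPath.isMaximalPath, fun h => ?_⟩
  by_cases hl : ∃ x ∈ P, T.IsLeaf x
  · obtain ⟨x, hx, hl⟩ := hl
    exact Or.inr ⟨x, hl, h.eq_of_isLeaf hx hl⟩
  · push Not at hl
    exact Or.inl (h.isRay hl)

lemma Boundary.isMaximalPath (ζ : T.Boundary) : T.IsMaximalPath ζ.1 :=
  isBoundaryPoint_iff_isMaximalPath.1 ζ.2

lemma IsMaximalPath.exists_length_eq_or_isLeaf (h : T.IsMaximalPath P) (n : ℕ) :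
    ∃ x ∈ P, x.length = n ∨ x.length ≤ n ∧ T.IsLeaf x := by
  induction n with
  | zero => exact ⟨[], h.nil_mem, Or.inl rfl⟩
  | succ n ih =>
    obtain ⟨x, hx, hxn⟩ := ih
    by_cases hl : T.IsLeaf x
    · exact ⟨x, hx, Or.inr ⟨by omega, hl⟩⟩
    · obtain ⟨a, ha⟩ := h.exists_concat_mem x hx hl
      exact ⟨_, ha, Or.inl (by simpa [hl] using hxn)⟩

lemma IsMaximalPath.of_isLeaf (h : T.IsMaximalPath P) (hmem : ∀ x ∈ P, x ∈ S.carrier)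
    (hleaf : ∀ x ∈ P, T.IsLeaf x → S.IsLeaf x) : S.IsMaximalPath P :=
  ⟨h.nil_mem, hmem, h.mem_of_prefix, h.chain,
    fun x hx hl => h.exists_concat_mem x hx (mt (hleaf x hx) hl)⟩

lemma IsBoundaryPoint.commonSubtree (hT : T.IsBoundaryPoint P) (hS : S.IsBoundaryPoint P) :
    (T.commonSubtree S).IsBoundaryPoint P := by
  rw [isBoundaryPoint_iff_isMaximalPath] at hT hS ⊢
  have hmem : ∀ x ∈ P, x ∈ (T.commonSubtree S).carrier := fun x hx =>
    ⟨hT.mem_carrier x hx, hS.mem_carrier x hx⟩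
  exact hT.of_isLeaf hmem fun x hx hl => ⟨hmem x hx, fun a ha => hl.2 a ha.1⟩

/-! ### The topology of the boundary -/

/-- The boundary points that pass through the word `x`: the boundary of the tent rooted in `x` if
`x` is an edge of `T`, and the empty set otherwise. -/
def tent (T : LocallyFiniteTree) (x : List ℕ) : Set T.Boundary := {ζ | x ∈ ζ.1}

lemma tent_eq_empty {x : List ℕ} (hx : x ∉ T.carrier) : T.tent x = ∅ :=
  Set.eq_empty_of_forall_notMem fun ζ hζ => hx (ζ.isMaximalPath.mem_carrier x hζ)

lemma tent_nil : T.tent [] = Set.univ :=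
  Set.eq_univ_of_forall fun ζ => ζ.isMaximalPath.nil_mem

lemma isTopologicalBasis_tentBoundary :
    TopologicalSpace.IsTopologicalBasis (Set.range T.tentBoundary) where
  exists_subset_inter := by
    rintro _ ⟨x, rfl⟩ _ ⟨y, rfl⟩ ζ ⟨hx, hy⟩
    rcases ζ.isMaximalPath.chain _ hx _ hy with h | h
    · exact ⟨_, ⟨y, rfl⟩, hy, fun ξ hξ => ⟨ξ.isMaximalPath.mem_of_prefix _ _ hξ h, hξ⟩⟩
    · exact ⟨_, ⟨x, rfl⟩, hx, fun ξ hξ => ⟨hξ, ξ.isMaximalPath.mem_of_prefix _ _ hξ h⟩⟩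
  sUnion_eq := Set.eq_univ_of_forall fun ζ =>
    ⟨_, ⟨⟨[], T.root_mem⟩, rfl⟩, ζ.isMaximalPath.nil_mem⟩
  eq_generateFrom := rfl

lemma isOpen_tent (x : List ℕ) : IsOpen (T.tent x) := by
  by_cases hx : x ∈ T.carrier
  · exact isTopologicalBasis_tentBoundary.isOpen ⟨⟨x, hx⟩, rfl⟩
  · exact tent_eq_empty hx ▸ isOpen_empty

lemma exists_tent_subset {U : Set T.Boundary} (hU : IsOpen U) {ζ : T.Boundary} (hζ : ζ ∈ U) :
    ∃ x ∈ ζ.1, T.tent x ⊆ U := by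
  obtain ⟨_, ⟨x, rfl⟩, hx, hxU⟩ := isTopologicalBasis_tentBoundary.exists_subset_of_mem_open hζ hU
  exact ⟨x.1, hx, hxU⟩

lemma isClosed_tent (x : List ℕ) : IsClosed (T.tent x) := by
  rw [← isOpen_compl_iff, isOpen_iff_forall_mem_open]
  intro ζ hζ
  obtain ⟨y, hy, hyx⟩ := ζ.isMaximalPath.exists_length_eq_or_isLeaf x.length
  refine ⟨T.tent y, fun ξ (hξ : y ∈ ξ.1) (hx : x ∈ ξ.1) => hζ ?_, isOpen_tent y, hy⟩
  rcases hyx with hlen | ⟨-, hl⟩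
  · rcases ξ.isMaximalPath.chain _ hξ _ hx with h | h
    · rwa [h.eq_of_length hlen] at hy
    · rwa [← h.eq_of_length hlen.symm] at hy
  · rw [ξ.isMaximalPath.eq_of_isLeaf hξ hl] at hx
    exact ζ.isMaximalPath.mem_of_prefix _ _ hy hx

lemma measurableSet_tent (x : List ℕ) : MeasurableSet (T.tent x) :=
  (isOpen_tent x).measurableSet

instance : Countable T.Edge := inferInstanceAs (Countable {x : List ℕ // x ∈ T.carrier})

instance : SecondCountableTopology T.Boundary :=
  isTopologicalBasis_tentBoundary.secondCountableTopology (Set.countable_range _)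

lemma borel_boundary_eq_generateFrom :
    borel T.Boundary = MeasurableSpace.generateFrom (Set.range T.tentBoundary) :=
  borel_eq_generateFrom_of_subbasis rfl

instance : RegularSpace T.Boundary := by
  refine RegularSpace.of_exists_mem_nhds_isClosed_subset fun ζ s hs => ?_
  obtain ⟨U, hUs, hU, hζ⟩ := mem_nhds_iff.1 hs
  obtain ⟨x, hx, hxU⟩ := exists_tent_subset hU hζ
  exact ⟨T.tent x, (isOpen_tent x).mem_nhds hx, isClosed_tent x, hxU.trans hUs⟩

/-! ### Potentials and capacities -/

/-- The edges of the geodesic from the root to the end of the edge `x`, `x` included. -/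
def prefixes (x : List ℕ) : Finset (List ℕ) := x.inits.toFinset

lemma mem_prefixes {x y : List ℕ} : y ∈ prefixes x ↔ y <+: x := by
  simp [prefixes]

lemma self_mem_prefixes (x : List ℕ) : x ∈ prefixes x := mem_prefixes.2 List.prefix_rfl

lemma concat_notMem_prefixes (x : List ℕ) (a : ℕ) : x ++ [a] ∉ prefixes x := fun h => by
  simpa using (mem_prefixes.1 h).length_le

lemma prefixes_nil : prefixes [] = {[]} := rfl

lemma prefixes_concat (x : List ℕ) (a : ℕ) :
    prefixes (x ++ [a]) = insert (x ++ [a]) (prefixes x) := by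
  ext y
  simp [mem_prefixes, List.prefix_concat_iff]

/-- The restriction to the edges of `T` of a function of the edges of the universal tree. -/
def restrict (T : LocallyFiniteTree) (g : List ℕ → ℝ≥0) (α : T.Edge) : ℝ≥0 := g α.1

lemma potential_restrict (g : List ℕ → ℝ≥0) (ζ : T.Boundary) :
    T.potential (T.restrict g) ζ = ∑' x : ζ.1, (g x : ℝ≥0∞) := by
  let e : {α : T.Edge // α.1 ∈ ζ.1} ≃ ζ.1 :=
    { toFun := fun α => ⟨α.1.1, α.2⟩
      invFun := fun x => ⟨⟨x.1, ζ.isMaximalPath.mem_carrier _ x.2⟩, x.2⟩ }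
  exact e.tsum_eq fun x : ζ.1 => (g x : ℝ≥0∞)

lemma potential_restrict_congr {f g : List ℕ → ℝ≥0} {ζ : T.Boundary} {ξ : S.Boundary}
    (h : ζ.1 = ξ.1) (hfg : ∀ x ∈ ξ.1, f x = g x) :
    T.potential (T.restrict f) ζ = S.potential (S.restrict g) ξ := by
  rw [potential_restrict, potential_restrict, h]
  exact tsum_congr fun x => by rw [hfg x x.2]

lemma sum_prefixes_le_potential (g : List ℕ → ℝ≥0) {ζ : T.Boundary} {x : List ℕ} (hx : x ∈ ζ.1) :
    ((∑ y ∈ prefixes x, g y : ℝ≥0) : ℝ≥0∞) ≤ T.potential (T.restrict g) ζ := by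
  rw [potential_restrict, ENNReal.ofNNReal_finsetSum, ← Finset.tsum_subtype']
  exact ENNReal.tsum_mono_subtype (fun y => (g y : ℝ≥0∞)) fun y hy =>
    ζ.isMaximalPath.mem_of_prefix _ _ hx (mem_prefixes.1 hy)

lemma potential_le {g : List ℕ → ℝ≥0} {ζ : T.Boundary} {b : ℝ≥0}
    (h : ∀ x ∈ ζ.1, ∑ y ∈ prefixes x, g y ≤ b) : T.potential (T.restrict g) ζ ≤ b := by
  rw [potential_restrict, ENNReal.tsum_eq_iSup_sum]
  refine iSup_le fun s => ?_
  rcases s.eq_empty_or_nonempty with rfl | hs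
  · simp
  obtain ⟨x, -, hmax⟩ := s.exists_max_image (fun y => y.1.length) hs
  have hsub : s.map (Function.Embedding.subtype _) ⊆ prefixes x.1 := fun y hy => by
    obtain ⟨z, hz, rfl⟩ := Finset.mem_map.1 hy
    rcases ζ.isMaximalPath.chain _ z.2 _ x.2 with hzx | hxz
    · exact mem_prefixes.2 hzx
    · exact mem_prefixes.2 (hxz.eq_of_length_le (hmax z hz) ▸ List.prefix_rfl)
  rw [← ENNReal.ofNNReal_finsetSum, ENNReal.coe_le_coe]
  calc ∑ y ∈ s, g y = ∑ y ∈ s.map (Function.Embedding.subtype _), g y := by simp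
    _ ≤ ∑ y ∈ prefixes x.1, g y := Finset.sum_le_sum_of_subset hsub
    _ ≤ b := h x.1 x.2

lemma normPow_restrict_le {p : ℝ} (hp : 0 < p) {g : List ℕ → ℝ≥0} (hg : ∀ x ∉ S.carrier, g x = 0) :
    T.normPow p (T.restrict g) ≤ S.normPow p (S.restrict g) := by
  have hS : S.normPow p (S.restrict g) = ∑' x : List ℕ, (g x : ℝ≥0∞) ^ p := by
    refine tsum_subtype_eq_of_support_subset (f := fun x => (g x : ℝ≥0∞) ^ p)
      (s := {x | x ∈ S.carrier}) fun x hx => ?_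
    by_contra h
    exact hx (by simp [hg x h, hp])
  rw [hS]
  exact ENNReal.tsum_comp_le_tsum_of_injective Subtype.val_injective fun x => (g x : ℝ≥0∞) ^ p

lemma capacity_le_capacity {p : ℝ} (hp : 0 < p) {A : Set T.Boundary} {B : Set S.Boundary}
    (h : ∀ ζ ∈ A, ∃ ξ ∈ B, ξ.1 = ζ.1) : T.capacity p A ≤ S.capacity p B := by
  refine le_iInf₂ fun f hf => ?_
  let g : List ℕ → ℝ≥0 := Function.extend Subtype.val f 0
  have hfg : S.restrict g = f := funext (Subtype.val_injective.extend_apply f 0)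
  have hg : ∀ x ∉ S.carrier, g x = 0 := fun x hx =>
    Function.extend_apply' _ _ x fun ⟨α, hα⟩ => hx (hα ▸ α.2)
  have hle : T.normPow p (T.restrict g) ≤ S.normPow p f := hfg ▸ normPow_restrict_le hp hg
  refine (iInf₂_le (T.restrict g) ⟨hle.trans_lt hf.1, fun ζ hζ => ?_⟩).trans hle
  obtain ⟨ξ, hξ, hξζ⟩ := h ζ hζ
  exact (hf.2 ξ hξ).trans_eq (hfg ▸ potential_restrict_congr hξζ fun _ _ => rfl)

/-! ### Duality between measures and test functions -/

section Duality

variable {p : ℝ} {μ : Measure T.Boundary}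

lemma potential_eq_tsum_indicator (f : T.Edge → ℝ≥0) (ζ : T.Boundary) :
    T.potential f ζ = ∑' α, (T.tentBoundary α).indicator (fun _ => (f α : ℝ≥0∞)) ζ :=
  tsum_subtype {α : T.Edge | α.1 ∈ ζ.1} fun α => (f α : ℝ≥0∞)

lemma measurableSet_tentBoundary (α : T.Edge) : MeasurableSet (T.tentBoundary α) :=
  measurableSet_tent α.1

lemma measurable_potential (f : T.Edge → ℝ≥0) : Measurable (T.potential f) := by
  simp_rw [funext (potential_eq_tsum_indicator f)]
  exact Measurable.tsum fun α => measurable_const.indicator (measurableSet_tentBoundary α)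

lemma lintegral_potential (f : T.Edge → ℝ≥0) :
    ∫⁻ ζ, T.potential f ζ ∂μ = ∑' α, f α * μ (T.tentBoundary α) := by
  simp_rw [potential_eq_tsum_indicator]
  rw [lintegral_tsum fun α =>
    (measurable_const.indicator (measurableSet_tentBoundary α)).aemeasurable]
  exact tsum_congr fun α => lintegral_indicator_const (measurableSet_tentBoundary α) _

lemma copotentialPow_rpow (hp : 1 < p) [IsFiniteMeasure μ] (α : T.Edge) :
    (T.copotentialPow p μ α : ℝ≥0∞) ^ p = μ (T.tentBoundary α) ^ p.conjExponent := by
  have hpq := Real.HolderConjugate.conjExponent hp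
  rw [copotentialPow, ENNReal.coe_rpow_of_nonneg _ hpq.symm.sub_one_pos.le,
    ENNReal.coe_toNNReal (measure_ne_top μ _), ← ENNReal.rpow_mul, hpq.symm.sub_one_mul_conj]

lemma lintegral_potential_copotentialPow (hp : 1 < p) [IsFiniteMeasure μ] :
    ∫⁻ ζ, T.potential (T.copotentialPow p μ) ζ ∂μ = T.normPow p (T.copotentialPow p μ) := by
  have hpq := Real.HolderConjugate.conjExponent hp
  rw [lintegral_potential]
  refine tsum_congr fun α => ?_
  rw [copotentialPow_rpow hp, copotentialPow, ENNReal.coe_rpow_of_nonneg _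
    hpq.symm.sub_one_pos.le, ENNReal.coe_toNNReal (measure_ne_top μ _)]
  nth_rw 2 [← ENNReal.rpow_one (μ (T.tentBoundary α))]
  rw [← ENNReal.rpow_add_of_nonneg _ _ hpq.symm.sub_one_pos.le zero_le_one, sub_add_cancel]

lemma measure_le_normPow_div_add (hp : 1 < p) [IsFiniteMeasure μ] {A : Set T.Boundary}
    {f : T.Edge → ℝ≥0} (hf : ∀ ζ ∈ A, 1 ≤ T.potential f ζ) :
    μ A ≤ T.normPow p f / ENNReal.ofReal p +
      T.normPow p (T.copotentialPow p μ) / ENNReal.ofReal p.conjExponent := by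
  calc μ A = ∫⁻ _ in A, 1 ∂μ := by simp
    _ ≤ ∫⁻ ζ in A, T.potential f ζ ∂μ := setLIntegral_mono (measurable_potential f) hf
    _ ≤ ∫⁻ ζ, T.potential f ζ ∂μ := setLIntegral_le_lintegral _ _
    _ = ∑' α, f α * μ (T.tentBoundary α) := lintegral_potential f
    _ ≤ ∑' α, ((f α : ℝ≥0∞) ^ p / ENNReal.ofReal p +
          (T.copotentialPow p μ α : ℝ≥0∞) ^ p / ENNReal.ofReal p.conjExponent) := by
        refine ENNReal.tsum_le_tsum fun α => ?_
        rw [copotentialPow_rpow hp]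
        exact ENNReal.young_inequality _ _ (Real.HolderConjugate.conjExponent hp)
    _ = _ := by
        rw [ENNReal.tsum_add]
        simp_rw [div_eq_mul_inv, ENNReal.tsum_mul_right]
        rfl

lemma measure_le_capacity_div_add (hp : 1 < p) [IsFiniteMeasure μ] (A : Set T.Boundary) :
    μ A ≤ T.capacity p A / ENNReal.ofReal p +
      T.normPow p (T.copotentialPow p μ) / ENNReal.ofReal p.conjExponent := by
  have hp0 : ENNReal.ofReal p ≠ 0 := by simpa using zero_lt_one.trans hp
  rw [← tsub_le_iff_right, ENNReal.le_div_iff_mul_le (Or.inl hp0) (Or.inl ENNReal.ofReal_ne_top)]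
  refine le_iInf₂ fun f hf => ?_
  rw [← ENNReal.le_div_iff_mul_le (Or.inl hp0) (Or.inl ENNReal.ofReal_ne_top), tsub_le_iff_right]
  exact measure_le_normPow_div_add hp hf.2

lemma normPow_copotentialPow_le (hp : 1 < p) [IsFiniteMeasure μ]
    (h : ∀ ζ, T.potential (T.copotentialPow p μ) ζ ≤ 1) :
    T.normPow p (T.copotentialPow p μ) ≤ μ Set.univ := by
  rw [← lintegral_potential_copotentialPow hp, ← lintegral_one]
  exact lintegral_mono h

lemma measure_univ_le_capacity_add (hp : 1 < p) [IsFiniteMeasure μ]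
    (h : ∀ ζ, T.potential (T.copotentialPow p μ) ζ ≤ 1) {A : Set T.Boundary} {e : ℝ≥0∞}
    (he : μ Aᶜ ≤ e / ENNReal.ofReal p) : μ Set.univ ≤ T.capacity p A + e := by
  refine le_of_le_div_add_div (Real.HolderConjugate.conjExponent hp) (measure_ne_top μ _) ?_
  calc μ Set.univ ≤ μ A + μ Aᶜ := measure_univ_le_add_compl A
    _ ≤ T.capacity p A / ENNReal.ofReal p + μ Set.univ / ENNReal.ofReal p.conjExponent +
        e / ENNReal.ofReal p := by
      grw [measure_le_capacity_div_add hp A, normPow_copotentialPow_le hp h, he]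
    _ = (T.capacity p A + e) / ENNReal.ofReal p + μ Set.univ / ENNReal.ofReal p.conjExponent := by
      rw [ENNReal.add_div]
      ring

lemma measure_univ_le_boundaryCapacity (hp : 1 < p) [IsFiniteMeasure μ]
    (h : ∀ ζ, T.potential (T.copotentialPow p μ) ζ ≤ 1) :
    μ Set.univ ≤ T.boundaryCapacity p := by
  simpa [boundaryCapacity] using
    measure_univ_le_capacity_add hp h (A := Set.univ) (e := 0) (by simp)

lemma hasRegularBoundary_of_potential_eq_one (hp : 1 < p) [IsFiniteMeasure μ]
    (h : ∀ ζ, T.potential (T.copotentialPow p μ) ζ = 1) :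
    T.HasRegularBoundary p ∧ T.boundaryCapacity p = μ Set.univ := by
  have hnorm := normPow_copotentialPow_le hp fun ζ => (h ζ).le
  have htest : T.copotentialPow p μ ∈ T.testFunctions p Set.univ :=
    ⟨hnorm.trans_lt (measure_lt_top μ _), fun ζ _ => (h ζ).ge⟩
  have hle : T.boundaryCapacity p ≤ T.normPow p (T.copotentialPow p μ) := iInf₂_le _ htest
  have hge := measure_univ_le_boundaryCapacity hp fun ζ => (h ζ).le
  refine ⟨⟨μ, ⟨inferInstance, by simp, ⟨fun δ hδ => ⟨_, htest, ?_⟩, ?_⟩, ?_⟩, ?_⟩, ?_⟩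
  · simpa [zero_lt_one.trans hp] using hδ
  · exact (hnorm.trans hge).antisymm hle
  · rw [closure_univ]
    exact hge.antisymm (hle.trans hnorm)
  · exact Set.eq_empty_of_forall_notMem fun ζ hζ => (h ζ).not_lt hζ.2
  · exact (hle.trans hnorm).antisymm hge

lemma ae_one_le_potential_copotentialPow (hp : 1 < p) [IsFiniteMeasure μ]
    (h : ∀ ζ, T.potential (T.copotentialPow p μ) ζ ≤ 1)
    (hμ : μ Set.univ = T.boundaryCapacity p) :
    ∀ᵐ ζ ∂μ, 1 ≤ T.potential (T.copotentialPow p μ) ζ := by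
  have hle : μ Set.univ ≤ T.normPow p (T.copotentialPow p μ) := by
    refine le_of_le_div_add_div (Real.HolderConjugate.conjExponent hp).symm
      (measure_ne_top μ _) ?_
    calc μ Set.univ ≤ _ := measure_le_capacity_div_add hp Set.univ
      _ = _ := by rw [hμ, add_comm, boundaryCapacity]
  have hae := ae_eq_of_ae_le_of_lintegral_le (ae_of_all μ h)
    (by
      rw [lintegral_potential_copotentialPow hp]
      exact ((normPow_copotentialPow_le hp h).trans_lt (measure_lt_top μ _)).ne)
    aemeasurable_const (by rwa [lintegral_one, lintegral_potential_copotentialPow hp])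
  exact hae.mono fun ζ hζ => hζ.ge

end Duality

/-! ### The measure of a flow -/

/-- A flow on `T`: a function of the edges which at every edge that is not a leaf is the sum of its
values at the edges that follow. These are the co-potentials `α ↦ μ(∂T_α)` of the finite Borel
measures on the boundary, extended by zero to the universal tree. -/
structure IsFlow (T : LocallyFiniteTree) (M : List ℕ → ℝ≥0) : Prop where
  eq_zero : ∀ x ∉ T.carrier, M x = 0
  hasSum : ∀ x, ¬ T.IsLeaf x → HasSum (fun a => M (x ++ [a])) (M x)

/-- The left endpoint of the interval coding the word `x`. -/
def leftEnd (M : List ℕ → ℝ≥0) (x : List ℕ) : ℝ≥0 :=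
  List.reverseRecOn x 0 fun y a r => r + ∑ b ∈ Finset.range a, M (y ++ [b])

/-- The interval coding the word `x`, of length `M x`. If `M` is a flow then the intervals of the
edges following `x` split it from left to right, so that every number in the interval of the root
edge codes a boundary point; the measure of the flow is the image of Lebesgue measure. -/
def codeInterval (M : List ℕ → ℝ≥0) (x : List ℕ) : Set ℝ :=
  Set.Ico (leftEnd M x : ℝ) ((leftEnd M x + M x : ℝ≥0) : ℝ)

section Code

variable {M : List ℕ → ℝ≥0}

lemma leftEnd_concat (x : List ℕ) (a : ℕ) :
    leftEnd M (x ++ [a]) = leftEnd M x + ∑ b ∈ Finset.range a, M (x ++ [b]) := by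
  simp [leftEnd]

lemma leftEnd_concat_add (x : List ℕ) (a : ℕ) :
    leftEnd M (x ++ [a]) + M (x ++ [a]) =
      leftEnd M x + ∑ b ∈ Finset.range (a + 1), M (x ++ [b]) := by
  rw [leftEnd_concat, Finset.sum_range_succ, add_assoc]

lemma eq_of_mem_codeInterval_concat {x : List ℕ} {a b : ℕ} {t : ℝ}
    (ha : t ∈ codeInterval M (x ++ [a])) (hb : t ∈ codeInterval M (x ++ [b])) : a = b := by
  wlog hab : a < b generalizing a b
  · exact (not_lt.1 hab).eq_or_lt.elim Eq.symm fun hba => (this hb ha hba).symm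
  have hle : leftEnd M (x ++ [a]) + M (x ++ [a]) ≤ leftEnd M (x ++ [b]) := by
    rw [leftEnd_concat_add, leftEnd_concat]
    gcongr
    omega
  exact absurd (ha.2.trans_le (NNReal.coe_le_coe.2 hle)) hb.1.not_gt

end Code

namespace IsFlow

variable {M : List ℕ → ℝ≥0} (hM : T.IsFlow M)
include hM

lemma mem_carrier {x : List ℕ} {t : ℝ} (ht : t ∈ codeInterval M x) : x ∈ T.carrier := by
  by_contra h
  simp [codeInterval, hM.eq_zero x h] at ht

lemma codeInterval_concat_subset (x : List ℕ) (a : ℕ) :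
    codeInterval M (x ++ [a]) ⊆ codeInterval M x := by
  intro t ht
  have hsum := hM.hasSum x fun hl => hl.2 a (hM.mem_carrier ht)
  refine Set.Ico_subset_Ico ?_ ?_ ht
  · exact NNReal.coe_le_coe.2 (leftEnd_concat x a ▸ le_self_add)
  · rw [leftEnd_concat_add, NNReal.coe_le_coe]
    gcongr
    exact sum_le_hasSum _ (fun _ _ => zero_le) hsum

lemma codeInterval_subset_of_prefix {x y : List ℕ} (h : x <+: y) :
    codeInterval M y ⊆ codeInterval M x := by
  obtain ⟨z, rfl⟩ := h
  induction z using List.reverseRecOn with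
  | nil => rw [List.append_nil]
  | append_singleton z a ih =>
    rw [← List.append_assoc]
    exact (hM.codeInterval_concat_subset _ a).trans ih

lemma exists_mem_codeInterval_concat {x : List ℕ} {t : ℝ} (ht : t ∈ codeInterval M x)
    (hl : ¬ T.IsLeaf x) : ∃ a, t ∈ codeInterval M (x ++ [a]) := by
  classical
  have hlim : Tendsto (fun n => ((leftEnd M x + ∑ b ∈ Finset.range n, M (x ++ [b]) : ℝ≥0) : ℝ))
      atTop (𝓝 ((leftEnd M x + M x : ℝ≥0) : ℝ)) :=
    NNReal.tendsto_coe.2 ((hM.hasSum x hl).tendsto_sum_nat.const_add _)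
  have hex := (hlim.eventually_const_lt ht.2).exists
  obtain ⟨a, ha⟩ := Nat.exists_eq_add_one_of_ne_zero fun h0 : Nat.find hex = 0 => by
    simpa [ht.1.not_gt] using (Nat.find_eq_zero hex).1 h0
  refine ⟨a, ?_, ?_⟩
  · rw [leftEnd_concat]
    exact not_lt.1 (Nat.find_min hex (ha ▸ Nat.lt_add_one a))
  · rw [leftEnd_concat_add, ← ha]
    exact Nat.find_spec hex

lemma prefix_of_mem_codeInterval {x y : List ℕ} {t : ℝ} (hx : t ∈ codeInterval M x)
    (hy : t ∈ codeInterval M y) (h : x.length ≤ y.length) : x <+: y := by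
  induction x using List.reverseRecOn with
  | nil => exact List.nil_prefix
  | append_singleton x a ih =>
    rw [List.length_append, List.length_singleton] at h
    obtain ⟨_ | ⟨b, z⟩, rfl⟩ := ih (hM.codeInterval_concat_subset _ _ hx) (by omega)
    · simp at h
    · have hb : t ∈ codeInterval M (x ++ [b]) := hM.codeInterval_subset_of_prefix ⟨z, by simp⟩ hy
      rw [eq_of_mem_codeInterval_concat hx hb]
      exact ⟨z, by simp⟩

lemma isMaximalPath_code {t : ℝ} (ht : t ∈ codeInterval M []) :
    T.IsMaximalPath {x | t ∈ codeInterval M x} where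
  nil_mem := ht
  mem_carrier _ hx := hM.mem_carrier hx
  mem_of_prefix _ _ hy h := hM.codeInterval_subset_of_prefix h hy
  chain x hx y hy := (le_total x.length y.length).imp (hM.prefix_of_mem_codeInterval hx hy)
    (hM.prefix_of_mem_codeInterval hy hx)
  exists_concat_mem _ hx hl := hM.exists_mem_codeInterval_concat hx hl

/-- The boundary point coded by a number. -/
def code (t : codeInterval M []) : T.Boundary :=
  ⟨{x | t.1 ∈ codeInterval M x}, isBoundaryPoint_iff_isMaximalPath.2 (hM.isMaximalPath_code t.2)⟩

lemma measurable_code : Measurable hM.code := by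
  rw [BorelSpace.measurable_eq (α := T.Boundary), borel_boundary_eq_generateFrom]
  refine measurable_generateFrom ?_
  rintro _ ⟨x, rfl⟩
  exact measurable_subtype_coe (measurableSet_Ico (a := (leftEnd M x.1 : ℝ)))

/-- The measure on the boundary whose co-potential is the given flow. -/
def measure : Measure T.Boundary := (volume.comap Subtype.val).map hM.code

lemma measure_tent (x : List ℕ) : hM.measure (T.tent x) = M x := by
  have hpre : hM.code ⁻¹' T.tent x = Subtype.val ⁻¹' codeInterval M x := rfl
  rw [measure, Measure.map_apply hM.measurable_code (measurableSet_tent x), hpre,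
    comap_subtype_coe_apply (s := codeInterval M []) measurableSet_Ico, Subtype.image_preimage_coe,
    Set.inter_eq_right.2 (hM.codeInterval_subset_of_prefix List.nil_prefix), codeInterval,
    Real.volume_Ico, NNReal.coe_add, add_sub_cancel_left, ENNReal.ofReal_coe_nnreal]

lemma measure_univ : hM.measure Set.univ = M [] := tent_nil ▸ hM.measure_tent []

instance : IsFiniteMeasure hM.measure := ⟨hM.measure_univ ▸ ENNReal.coe_lt_top⟩

lemma copotentialPow_measure (p : ℝ) :
    T.copotentialPow p hM.measure = T.restrict fun x => M x ^ (p.conjExponent - 1) :=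
  funext fun α => congrArg (·.toNNReal ^ (p.conjExponent - 1)) (hM.measure_tent α.1)

end IsFlow

/-! ### Capacity profiles -/

/-- The part of the unit potential that is left after the root edge of a tent of capacity `t`: the
equilibrium function of the tent takes the value `t ^ (p - 1)⁻¹` there. -/
def residualRatio (p : ℝ) (t : ℝ≥0) : ℝ≥0 := 1 - t ^ (p - 1)⁻¹

/-- The part of the unit potential that is left before the edge `x`, if `d` gives the capacities of
the tents. -/
def residual (p : ℝ) (d : List ℕ → ℝ≥0) (x : List ℕ) : ℝ≥0 :=
  ∏ y ∈ (prefixes x).erase x, residualRatio p (d y)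

/-- The co-potential of the equilibrium measure, expressed through the capacities of the tents. -/
def equilibriumFlow (p : ℝ) (d : List ℕ → ℝ≥0) (x : List ℕ) : ℝ≥0 := residual p d x ^ (p - 1) * d x

/-- The equilibrium function, expressed through the capacities of the tents. -/
def equilibriumFun (p : ℝ) (d : List ℕ → ℝ≥0) (x : List ℕ) : ℝ≥0 :=
  residual p d x * d x ^ (p - 1)⁻¹

/-- A solution of the recursion satisfied by the capacities of the boundaries of the tents of `T`:
an edge with a subtree of capacity `C` at its end is a tent of capacity `t`, where
`t = (1 - t ^ (p - 1)⁻¹) ^ (p - 1) * C`. On an infinite tree there may be several solutions. -/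
structure IsCapacityProfile (T : LocallyFiniteTree) (p : ℝ) (d : List ℕ → ℝ≥0) : Prop where
  eq_zero : ∀ x ∉ T.carrier, d x = 0
  eq_one : ∀ x, T.IsLeaf x → d x = 1
  hasSum : ∀ x, ¬ T.IsLeaf x →
    HasSum (fun a => residualRatio p (d x) ^ (p - 1) * d (x ++ [a])) (d x)

section Profile

variable {p : ℝ} {d : List ℕ → ℝ≥0}

lemma residualRatio_le_one (t : ℝ≥0) : residualRatio p t ≤ 1 := tsub_le_self

lemma residualRatio_one : residualRatio p 1 = 0 := by simp [residualRatio]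

lemma residualRatio_add {t : ℝ≥0} (hp : 1 < p) (ht : t ≤ 1) :
    residualRatio p t + t ^ (p - 1)⁻¹ = 1 :=
  tsub_add_cancel_of_le (NNReal.rpow_le_one ht (inv_nonneg.2 (sub_pos.2 hp).le))

lemma residual_nil : residual p d [] = 1 := by simp [residual, prefixes_nil]

lemma residual_concat (x : List ℕ) (a : ℕ) :
    residual p d (x ++ [a]) = residual p d x * residualRatio p (d x) := by
  rw [residual, prefixes_concat, Finset.erase_insert (concat_notMem_prefixes x a), residual,
    Finset.prod_erase_mul _ _ (self_mem_prefixes x)]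

lemma equilibriumFlow_nil : equilibriumFlow p d [] = d [] := by
  simp [equilibriumFlow, residual_nil]

lemma equilibriumFlow_rpow (hp : 1 < p) (x : List ℕ) :
    equilibriumFlow p d x ^ (p - 1)⁻¹ = equilibriumFun p d x := by
  rw [equilibriumFlow, NNReal.mul_rpow, NNReal.rpow_rpow_inv (sub_pos.2 hp).ne', equilibriumFun]

namespace IsCapacityProfile

variable (hd : T.IsCapacityProfile p d)
include hd

lemma lt_one_of_not_isLeaf (hp : 1 < p) {x : List ℕ} (hx : ¬ T.IsLeaf x) : d x < 1 := by
  by_contra! h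
  have hratio : residualRatio p (d x) ^ (p - 1) = 0 := by
    rw [residualRatio, tsub_eq_zero_of_le (NNReal.one_le_rpow h (inv_nonneg.2 (sub_pos.2 hp).le)),
      NNReal.zero_rpow (sub_pos.2 hp).ne']
  have hsum := hd.hasSum x hx
  simp only [hratio, zero_mul] at hsum
  exact (zero_lt_one.trans_le h).ne (hasSum_zero.unique hsum)

lemma le_one (hp : 1 < p) (x : List ℕ) : d x ≤ 1 :=
  (em (T.IsLeaf x)).elim (fun h => (hd.eq_one x h).le) fun h => (hd.lt_one_of_not_isLeaf hp h).le

lemma sum_prefixes_equilibriumFun (hp : 1 < p) (x : List ℕ) :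
    ∑ y ∈ prefixes x, equilibriumFun p d y + residual p d x * residualRatio p (d x) = 1 := by
  have hsplit (y : List ℕ) :
      residual p d y * residualRatio p (d y) + equilibriumFun p d y = residual p d y := by
    rw [equilibriumFun, ← mul_add, residualRatio_add hp (hd.le_one hp y), mul_one]
  induction x using List.reverseRecOn with
  | nil => rw [prefixes_nil, Finset.sum_singleton, add_comm, hsplit, residual_nil]
  | append_singleton x a ih =>
    rw [prefixes_concat, Finset.sum_insert (concat_notMem_prefixes x a), add_comm, ← add_assoc,
      hsplit, residual_concat, add_comm, ih]

lemma equilibriumFun_eq_zero (hp : 1 < p) {x : List ℕ} (hx : x ∉ T.carrier) :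
    equilibriumFun p d x = 0 := by
  rw [equilibriumFun, hd.eq_zero x hx, NNReal.zero_rpow (inv_ne_zero (sub_pos.2 hp).ne'), mul_zero]

lemma isFlow : T.IsFlow (equilibriumFlow p d) where
  eq_zero x hx := by rw [equilibriumFlow, hd.eq_zero x hx, mul_zero]
  hasSum x hl := by
    simpa only [equilibriumFlow, residual_concat, NNReal.mul_rpow, mul_assoc] using
      (hd.hasSum x hl).mul_left (residual p d x ^ (p - 1))

lemma measure_univ : hd.isFlow.measure Set.univ = d [] := by
  rw [hd.isFlow.measure_univ, equilibriumFlow_nil]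

lemma copotentialPow_measure (hp : 1 < p) :
    T.copotentialPow p hd.isFlow.measure = T.restrict (equilibriumFun p d) := by
  have hconj : p.conjExponent - 1 = (p - 1)⁻¹ := by
    have := sub_pos.2 hp
    rw [Real.conjExponent]
    field_simp
    ring
  simp only [hd.isFlow.copotentialPow_measure, hconj, equilibriumFlow_rpow hp]

lemma potential_le_one (hp : 1 < p) (ζ : T.Boundary) :
    T.potential (T.restrict (equilibriumFun p d)) ζ ≤ 1 :=
  potential_le fun x _ => hd.sum_prefixes_equilibriumFun hp x ▸ le_self_add

lemma one_le_potential_of_eq_one (hp : 1 < p) {ζ : S.Boundary} {x : List ℕ} (hx : x ∈ ζ.1)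
    (h : d x = 1) : 1 ≤ S.potential (S.restrict (equilibriumFun p d)) ζ := by
  have hsum := hd.sum_prefixes_equilibriumFun hp x
  rw [h, residualRatio_one, mul_zero, add_zero] at hsum
  simpa [hsum] using sum_prefixes_le_potential (equilibriumFun p d) hx

lemma one_le_potential_of_tendsto (hp : 1 < p) {ζ : T.Boundary} {s : ℕ → List ℕ}
    (hs : ∀ n, s n ∈ ζ.1) (h : Tendsto (fun n => residual p d (s n)) atTop (𝓝 0)) :
    1 ≤ T.potential (T.restrict (equilibriumFun p d)) ζ := by
  have hbound (n : ℕ) :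
      1 ≤ T.potential (T.restrict (equilibriumFun p d)) ζ + residual p d (s n) := by
    grw [← sum_prefixes_le_potential _ (hs n)]
    rw [← ENNReal.coe_add, ENNReal.one_le_coe_iff,
      ← hd.sum_prefixes_equilibriumFun hp (s n)]
    gcongr
    exact mul_le_of_le_one_right' (residualRatio_le_one _)
  simpa using ge_of_tendsto' ((ENNReal.tendsto_coe.2 h).const_add _) hbound

lemma measure_potential_le_one (hp : 1 < p) (ζ : T.Boundary) :
    T.potential (T.copotentialPow p hd.isFlow.measure) ζ ≤ 1 :=
  hd.copotentialPow_measure hp ▸ hd.potential_le_one hp ζ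

lemma ae_forall_pos : ∀ᵐ ζ ∂hd.isFlow.measure, ∀ x ∈ ζ.1, 0 < d x := by
  refine ae_all_iff.2 fun x => ?_
  rcases (zero_le (a := d x)).eq_or_lt with hx | hx
  · have hnull : hd.isFlow.measure (T.tent x) = 0 := by
      rw [hd.isFlow.measure_tent, equilibriumFlow, ← hx, mul_zero, ENNReal.coe_zero]
    exact (measure_eq_zero_iff_ae_notMem.1 hnull).mono fun ζ hζ hxζ => absurd hxζ hζ
  · exact ae_of_all _ fun _ _ => hx

lemma le_boundaryCapacity (hp : 1 < p) : d [] ≤ T.boundaryCapacity p :=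
  hd.measure_univ ▸ measure_univ_le_boundaryCapacity hp (hd.measure_potential_le_one hp)

lemma normPow_equilibriumFun_le (hp : 1 < p) :
    T.normPow p (T.restrict (equilibriumFun p d)) ≤ d [] := by
  rw [← hd.copotentialPow_measure hp, ← hd.measure_univ]
  exact normPow_copotentialPow_le hp (hd.measure_potential_le_one hp)

lemma hasRegularBoundary (hp : 1 < p)
    (h : ∀ ζ, 1 ≤ T.potential (T.restrict (equilibriumFun p d)) ζ) :
    T.HasRegularBoundary p ∧ T.boundaryCapacity p = d [] := by
  rw [← hd.measure_univ]
  refine hasRegularBoundary_of_potential_eq_one hp fun ζ => ?_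
  rw [hd.copotentialPow_measure hp]
  exact (hd.potential_le_one hp ζ).antisymm (h ζ)

end IsCapacityProfile

end Profile

/-! ### The capacities of the tents -/

lemma finite_setOf_concat_mem (T : LocallyFiniteTree) (x : List ℕ) :
    {a : ℕ | x ++ [a] ∈ T.carrier}.Finite := by
  by_cases hx : x ∈ T.carrier
  · exact T.finite_children x hx
  · exact Set.finite_empty.subset fun a ha => hx (Descriptive.Tree.mem_of_append ha)

/-- The letters `a` for which the edge `x ++ [a]` follows `x` in `T`; there are none if `x` is not
an edge of `T`. -/
def children (T : LocallyFiniteTree) (x : List ℕ) : Finset ℕ :=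
  (T.finite_setOf_concat_mem x).toFinset

lemma mem_children {x : List ℕ} {a : ℕ} : a ∈ T.children x ↔ x ++ [a] ∈ T.carrier :=
  Set.Finite.mem_toFinset _

/-- The capacity of an edge with tents of total capacity `C` at its end: the resistances
`C ^ (-(p - 1)⁻¹)` and `1` are added. -/
def seriesCapacity (p : ℝ) (C : ℝ≥0) : ℝ≥0 := (C ^ (p - 1)⁻¹ / (1 + C ^ (p - 1)⁻¹)) ^ (p - 1)

section SeriesCapacity

variable {p : ℝ} (hp : 1 < p)
include hp

lemma seriesCapacity_zero : seriesCapacity p 0 = 0 := by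
  have := sub_pos.2 hp
  simp [seriesCapacity, this.ne']

lemma seriesCapacity_le_one (C : ℝ≥0) : seriesCapacity p C ≤ 1 :=
  NNReal.rpow_le_one (div_le_one_of_le₀ le_add_self zero_le) (sub_pos.2 hp).le

lemma monotone_seriesCapacity : Monotone (seriesCapacity p) := by
  intro C D h
  refine NNReal.rpow_le_rpow ?_ (sub_pos.2 hp).le
  have hCD : C ^ (p - 1)⁻¹ ≤ D ^ (p - 1)⁻¹ :=
    NNReal.rpow_le_rpow h (inv_nonneg.2 (sub_pos.2 hp).le)
  rw [div_le_div_iff₀ (by positivity) (by positivity), mul_add, mul_add, mul_one, mul_one,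
    mul_comm (D ^ (p - 1)⁻¹)]
  gcongr

lemma continuous_seriesCapacity : Continuous (seriesCapacity p) := by
  have hpow := NNReal.continuous_rpow_const (inv_nonneg.2 (sub_pos.2 hp).le)
  exact (NNReal.continuous_rpow_const (sub_pos.2 hp).le).comp
    (hpow.div₀ (hpow.const_add 1) fun C => by positivity)

lemma residualRatio_seriesCapacity (C : ℝ≥0) :
    residualRatio p (seriesCapacity p C) = (1 + C ^ (p - 1)⁻¹)⁻¹ := by
  rw [residualRatio, seriesCapacity, NNReal.rpow_rpow_inv (sub_pos.2 hp).ne']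
  refine tsub_eq_of_eq_add ?_
  field_simp

lemma residualRatio_seriesCapacity_rpow_mul (C : ℝ≥0) :
    residualRatio p (seriesCapacity p C) ^ (p - 1) * C = seriesCapacity p C := by
  nth_rw 2 [← NNReal.rpow_inv_rpow (sub_pos.2 hp).ne' C]
  rw [residualRatio_seriesCapacity hp, ← NNReal.mul_rpow, inv_mul_eq_div, seriesCapacity]

lemma hasSum_of_eq_seriesCapacity {d : List ℕ → ℝ≥0} (h0 : ∀ x ∉ T.carrier, d x = 0) {x : List ℕ}
    (hx : d x = seriesCapacity p (∑ a ∈ T.children x, d (x ++ [a]))) :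
    HasSum (fun a => residualRatio p (d x) ^ (p - 1) * d (x ++ [a])) (d x) := by
  have hsum : HasSum (fun a => d (x ++ [a])) (∑ a ∈ T.children x, d (x ++ [a])) :=
    hasSum_sum_of_ne_finset_zero fun a ha => h0 _ fun hxa => ha (mem_children.2 hxa)
  have hC := residualRatio_seriesCapacity_rpow_mul hp (∑ a ∈ T.children x, d (x ++ [a]))
  rw [← hx] at hC
  simpa only [hC] using hsum.mul_left (residualRatio p (d x) ^ (p - 1))

end SeriesCapacity

open Classical in
/-- The capacities of the tents of `T` cut off `n` levels above their root edges. -/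
def approxCapacity (T : LocallyFiniteTree) (p : ℝ) : ℕ → List ℕ → ℝ≥0
  | 0, x => if x ∈ T.carrier then 1 else 0
  | n + 1, x =>
    if T.IsLeaf x then 1 else seriesCapacity p (∑ a ∈ T.children x, approxCapacity T p n (x ++ [a]))

/-- The capacities of the boundaries of the tents of `T`. -/
def tentCapacity (T : LocallyFiniteTree) (p : ℝ) (x : List ℕ) : ℝ≥0 := ⨅ n, T.approxCapacity p n x

/-- The subtree of the edges of `T` of level at most `N`. -/
def truncate (T : LocallyFiniteTree) (N : ℕ) : LocallyFiniteTree where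
  carrier := ⟨{x | x ∈ T.carrier ∧ x.length ≤ N}, fun x a h =>
    ⟨Descriptive.Tree.mem_of_append h.1, (List.prefix_append x [a]).length_le.trans h.2⟩⟩
  root_mem := ⟨T.root_mem, N.zero_le⟩
  finite_children x hx := (T.finite_children x hx.1).subset fun _ ha => ha.1

/-- The capacities of the boundaries of the tents of `T.truncate N`. -/
def truncateCapacity (T : LocallyFiniteTree) (p : ℝ) (N : ℕ) (x : List ℕ) : ℝ≥0 :=
  if x.length ≤ N then T.approxCapacity p (N - x.length) x else 0

lemma mem_truncate {N : ℕ} {x : List ℕ} :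
    x ∈ (T.truncate N).carrier ↔ x ∈ T.carrier ∧ x.length ≤ N := Iff.rfl

section TentCapacity

variable {p : ℝ}

lemma approxCapacity_zero_of_mem {x : List ℕ} (hx : x ∈ T.carrier) : T.approxCapacity p 0 x = 1 :=
  if_pos hx

lemma approxCapacity_of_isLeaf {x : List ℕ} (hx : T.IsLeaf x) (n : ℕ) :
    T.approxCapacity p n x = 1 := by
  cases n
  exacts [if_pos hx.1, if_pos hx]

lemma approxCapacity_succ {x : List ℕ} (hx : ¬ T.IsLeaf x) (n : ℕ) :
    T.approxCapacity p (n + 1) x =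
      seriesCapacity p (∑ a ∈ T.children x, T.approxCapacity p n (x ++ [a])) :=
  if_neg hx

lemma truncateCapacity_of_isLeaf {N : ℕ} {x : List ℕ} (hx : (T.truncate N).IsLeaf x) :
    T.truncateCapacity p N x = 1 := by
  obtain ⟨hmem, hlen⟩ := mem_truncate.1 hx.1
  rw [truncateCapacity, if_pos hlen]
  rcases hlen.eq_or_lt with h | h
  · rw [h, Nat.sub_self, approxCapacity_zero_of_mem hmem]
  · exact approxCapacity_of_isLeaf ⟨hmem, fun a ha => hx.2 a ⟨ha, by simpa using h⟩⟩ _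

lemma truncateCapacity_eq_seriesCapacity {N : ℕ} {x : List ℕ} (hx : x ∈ (T.truncate N).carrier)
    (hl : ¬ (T.truncate N).IsLeaf x) : T.truncateCapacity p N x =
      seriesCapacity p (∑ a ∈ (T.truncate N).children x, T.truncateCapacity p N (x ++ [a])) := by
  have hlT : ¬ T.IsLeaf x := fun h => hl ⟨hx, fun a ha => h.2 a ha.1⟩
  have hlt : x.length + 1 ≤ N := by
    by_contra! h
    exact hl ⟨hx, fun a ha => h.not_ge (by simpa using ha.2)⟩
  have hchildren : (T.truncate N).children x = T.children x := by
    ext a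
    simp [mem_children, mem_truncate, hlt]
  obtain ⟨k, hk⟩ := Nat.exists_eq_add_of_le' hlt
  have hlevel : N - x.length = k + 1 := by omega
  have hnext : N - (x.length + 1) = k := by omega
  simp only [truncateCapacity, hx.2, hchildren, List.length_append, List.length_singleton, hlt,
    if_true, hlevel, hnext, approxCapacity_succ hlT]

variable (hp : 1 < p)
include hp

lemma approxCapacity_of_notMem {x : List ℕ} (hx : x ∉ T.carrier) (n : ℕ) :
    T.approxCapacity p n x = 0 := by
  cases n with
  | zero => exact if_neg hx
  | succ n =>
    have hchildren : T.children x = ∅ := Finset.eq_empty_of_forall_notMem fun a ha =>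
      hx (Descriptive.Tree.mem_of_append (mem_children.1 ha))
    rw [approxCapacity_succ fun hl => hx hl.1, hchildren, Finset.sum_empty, seriesCapacity_zero hp]

lemma approxCapacity_le_one (n : ℕ) (x : List ℕ) : T.approxCapacity p n x ≤ 1 := by
  cases n <;> rw [approxCapacity] <;> split_ifs
  exacts [le_rfl, zero_le_one, le_rfl, seriesCapacity_le_one hp _]

lemma antitone_approxCapacity (x : List ℕ) : Antitone fun n => T.approxCapacity p n x := by
  refine antitone_nat_of_succ_le fun n => ?_
  induction n generalizing x with
  | zero =>
    by_cases hx : x ∈ T.carrier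
    · exact approxCapacity_zero_of_mem (p := p) hx ▸ approxCapacity_le_one hp _ x
    · simp [approxCapacity_of_notMem hp hx]
  | succ n ih =>
    by_cases hx : T.IsLeaf x
    · simp [approxCapacity_of_isLeaf hx]
    · rw [approxCapacity_succ hx, approxCapacity_succ hx]
      exact monotone_seriesCapacity hp (Finset.sum_le_sum fun a _ => ih _)

lemma tendsto_approxCapacity (x : List ℕ) :
    Tendsto (fun n => T.approxCapacity p n x) atTop (𝓝 (T.tentCapacity p x)) :=
  tendsto_atTop_ciInf (antitone_approxCapacity hp x) (OrderBot.bddBelow _)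

lemma isCapacityProfile_tentCapacity : T.IsCapacityProfile p (T.tentCapacity p) where
  eq_zero x hx := by simp [tentCapacity, approxCapacity_of_notMem hp hx]
  eq_one x hx := by simp [tentCapacity, approxCapacity_of_isLeaf hx]
  hasSum x hl := by
    refine hasSum_of_eq_seriesCapacity (T := T) hp
      (fun y hy => by simp [tentCapacity, approxCapacity_of_notMem hp hy]) ?_
    have hlim := (tendsto_approxCapacity (T := T) hp x).comp (tendsto_add_atTop_nat 1)
    refine tendsto_nhds_unique (hlim.congr fun n => approxCapacity_succ hl n) ?_
    exact ((continuous_seriesCapacity hp).tendsto _).comp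
      (tendsto_finsetSum _ fun a _ => tendsto_approxCapacity hp _)

lemma truncateCapacity_of_notMem {N : ℕ} {x : List ℕ} (hx : x ∉ (T.truncate N).carrier) :
    T.truncateCapacity p N x = 0 := by
  rw [truncateCapacity]
  split_ifs with h
  exacts [approxCapacity_of_notMem hp (fun hxT => hx ⟨hxT, h⟩) _, rfl]

lemma isCapacityProfile_truncateCapacity (N : ℕ) :
    (T.truncate N).IsCapacityProfile p (T.truncateCapacity p N) where
  eq_zero _ := truncateCapacity_of_notMem hp
  eq_one _ := truncateCapacity_of_isLeaf
  hasSum x hl := by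
    by_cases hx : x ∈ (T.truncate N).carrier
    · exact hasSum_of_eq_seriesCapacity hp (fun _ => truncateCapacity_of_notMem hp)
        (truncateCapacity_eq_seriesCapacity hx hl)
    · have hchild (a : ℕ) : T.truncateCapacity p N (x ++ [a]) = 0 :=
        truncateCapacity_of_notMem hp fun h => hx (Descriptive.Tree.mem_of_append h)
      simpa only [hchild, truncateCapacity_of_notMem hp hx, mul_zero] using hasSum_zero

lemma one_le_potential_truncateCapacity (N : ℕ) (ζ : T.Boundary) :
    1 ≤ T.potential (T.restrict (equilibriumFun p (T.truncateCapacity p N))) ζ := by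
  obtain ⟨x, hx, h⟩ := ζ.isMaximalPath.exists_length_eq_or_isLeaf N
  refine (isCapacityProfile_truncateCapacity hp N).one_le_potential_of_eq_one hp hx
    (truncateCapacity_of_isLeaf ⟨⟨ζ.isMaximalPath.mem_carrier x hx, ?_⟩, fun a ha => ?_⟩)
  · exact h.elim Eq.le And.left
  · rcases h with h | h
    · simpa [h] using ha.2
    · exact h.2.2 a ha.1

lemma boundaryCapacity_eq : T.boundaryCapacity p = T.tentCapacity p [] := by
  refine le_antisymm ?_ ((isCapacityProfile_tentCapacity hp).le_boundaryCapacity hp)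
  refine ge_of_tendsto' (ENNReal.tendsto_coe.2 (tendsto_approxCapacity hp [])) fun N => ?_
  have hd := isCapacityProfile_truncateCapacity (T := T) hp N
  have hnorm : T.normPow p (T.restrict (equilibriumFun p (T.truncateCapacity p N))) ≤
      T.approxCapacity p N [] :=
    (normPow_restrict_le (zero_lt_one.trans hp) fun x => hd.equilibriumFun_eq_zero hp).trans
      (by simpa [truncateCapacity] using hd.normPow_equilibriumFun_le hp)
  exact (iInf₂_le _ ⟨hnorm.trans_lt ENNReal.coe_lt_top, fun ζ _ =>
    one_le_potential_truncateCapacity hp N ζ⟩).trans hnorm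

end TentCapacity

/-! ### Caterpillars -/

/-- An edge with tents of capacities `c a` at its end forms a tent of capacity `t`. Capacity one is
that of a leaf, which no edge follows. -/
structure IsSplitting (p : ℝ) (t : ℝ≥0) (c : ℕ → ℝ≥0) : Prop where
  finite : {a | c a ≠ 0}.Finite
  eq_zero : t = 1 → c = 0
  hasSum : t ≠ 1 → HasSum (fun a => residualRatio p t ^ (p - 1) * c a) t

/-- The total capacity of the tents at the end of an edge that forms with them a tent of
capacity `t`. For `t = 1` the division by zero gives `0`, in accordance with the edge being a
leaf. -/
def childrenCapacity (p : ℝ) (t : ℝ≥0) : ℝ≥0 := t / residualRatio p t ^ (p - 1)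

/-- The capacities of the tents at the end of an edge of capacity `t` of a caterpillar: as many
leaves as possible, and one more tent for the remainder. -/
def caterpillarChild (p : ℝ) (t : ℝ≥0) (a : ℕ) : ℝ≥0 := min 1 (childrenCapacity p t - a)

section Caterpillar

variable {p : ℝ} {t : ℝ≥0} {d : List ℕ → ℝ≥0}

lemma IsSplitting.eq_zero_of_eq_zero (hp : 1 < p) {c : ℕ → ℝ≥0} (hc : IsSplitting p t c)
    (ht : t = 0) : c = 0 := by
  subst ht
  have hratio : residualRatio p 0 ^ (p - 1) = 1 := by
    rw [residualRatio, NNReal.zero_rpow (inv_ne_zero (sub_pos.2 hp).ne'), tsub_zero,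
      NNReal.one_rpow]
  have hsum := hc.hasSum zero_ne_one
  simp only [hratio, one_mul] at hsum
  exact funext (hasSum_zero_iff.1 hsum)

lemma IsCapacityProfile.isSplitting (hd : T.IsCapacityProfile p d) (hp : 1 < p) (x : List ℕ) :
    IsSplitting p (d x) fun a => d (x ++ [a]) where
  finite := (T.finite_setOf_concat_mem x).subset fun _ ha => by_contra fun h => ha (hd.eq_zero _ h)
  eq_zero h := funext fun a => hd.eq_zero _ fun hxa =>
    (hd.lt_one_of_not_isLeaf hp fun hl => hl.2 a hxa).ne h
  hasSum h := hd.hasSum x fun hl => h (hd.eq_one x hl)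

lemma residualRatio_pos (hp : 1 < p) (ht : t < 1) : 0 < residualRatio p t :=
  tsub_pos_of_lt (NNReal.rpow_lt_one ht (inv_pos.2 (sub_pos.2 hp)))

lemma isSplitting_caterpillarChild (hp : 1 < p) (ht : t ≤ 1) :
    IsSplitting p t (caterpillarChild p t) where
  finite := by
    obtain ⟨N, hN⟩ := exists_nat_ge (childrenCapacity p t)
    refine (Set.finite_lt_nat N).subset fun a ha => ?_
    by_contra h
    have hNa : childrenCapacity p t ≤ a := hN.trans (Nat.cast_le.2 (not_lt.1 h))
    exact ha (by simp [caterpillarChild, tsub_eq_zero_of_le hNa])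
  eq_zero h := by
    ext a
    simp [caterpillarChild, childrenCapacity, h, residualRatio_one, (sub_pos.2 hp).ne']
  hasSum h := by
    have hratio := NNReal.rpow_pos (residualRatio_pos hp (ht.lt_of_ne h)) (p := p - 1)
    have hsum := (hasSum_min_one_sub (childrenCapacity p t)).mul_left (residualRatio p t ^ (p - 1))
    rwa [childrenCapacity, mul_div_cancel₀ _ hratio.ne'] at hsum

lemma childrenCapacity_rpow (hp : 1 < p) :
    childrenCapacity p t ^ (p - 1)⁻¹ = t ^ (p - 1)⁻¹ / residualRatio p t := by
  rw [childrenCapacity, NNReal.div_rpow, NNReal.rpow_rpow_inv (sub_pos.2 hp).ne']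

lemma resistance_caterpillarChild (hp : 1 < p) (ht : 2 < (t ^ (p - 1)⁻¹)⁻¹) {a : ℕ}
    (ha : caterpillarChild p t a ≠ 0) :
    (caterpillarChild p t a ^ (p - 1)⁻¹)⁻¹ + 1 = (t ^ (p - 1)⁻¹)⁻¹ := by
  have hq : 0 < (p - 1)⁻¹ := inv_pos.2 (sub_pos.2 hp)
  set u := t ^ (p - 1)⁻¹ with hu
  have hu0 : u ≠ 0 := fun h => by simp [h] at ht
  have hu2 : u < 2⁻¹ := lt_inv_of_lt_inv₀ two_pos ht
  have hratio : residualRatio p t + u = 1 := tsub_add_cancel_of_le (hu2.le.trans (by norm_num))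
  have hle : u ≤ residualRatio p t := by
    rw [← NNReal.coe_le_coe]
    have h1 := congrArg NNReal.toReal hratio
    have h2 := NNReal.coe_lt_coe.2 hu2
    push_cast at h1 h2
    linarith
  have hC : childrenCapacity p t ≤ 1 := by
    rw [← NNReal.rpow_le_rpow_iff hq, childrenCapacity_rpow hp, NNReal.one_rpow]
    exact div_le_one_of_le₀ hle zero_le
  have ha0 : a = 0 := by
    by_contra h
    have : (1 : ℝ≥0) ≤ a := by exact_mod_cast Nat.one_le_iff_ne_zero.2 h
    exact ha (by simp [caterpillarChild, tsub_eq_zero_of_le (hC.trans this)])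
  rw [ha0, caterpillarChild, Nat.cast_zero, tsub_zero, min_eq_right hC, childrenCapacity_rpow hp,
    ← hu, inv_div]
  calc residualRatio p t / u + 1 = (residualRatio p t + u) / u := by rw [add_div, div_self hu0]
    _ = u⁻¹ := by rw [hratio, one_div]

/-! ### Replacing tents by caterpillars -/

open Classical in
/-- The capacities of the tents after the tents rooted at the end of the edges of `cut` have been
replaced: from there on, the capacities are split as in a caterpillar. -/
def regraft (p : ℝ) (d : List ℕ → ℝ≥0) (cut : Set (List ℕ)) (x : List ℕ) : ℝ≥0 :=
  List.reverseRecOn x (d []) fun y a r =>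
    if y ∈ cut then caterpillarChild p r a else d (y ++ [a])

/-- The tree of the edges where a function that satisfies the recursion for the capacities of the
tents does not vanish. -/
def supportTree (hp : 1 < p) (h0 : d [] ≠ 0)
    (hd : ∀ x, IsSplitting p (d x) fun a => d (x ++ [a])) : LocallyFiniteTree where
  carrier := ⟨{x | d x ≠ 0}, fun x a h hx => h (congrFun ((hd x).eq_zero_of_eq_zero hp hx) a)⟩
  root_mem := h0
  finite_children x _ := (hd x).finite

lemma isCapacityProfile_supportTree (hp : 1 < p) (h0 : d [] ≠ 0)
    (hd : ∀ x, IsSplitting p (d x) fun a => d (x ++ [a])) :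
    (supportTree hp h0 hd).IsCapacityProfile p d where
  eq_zero x hx := not_not.1 hx
  eq_one x hx := by
    by_contra h
    have hchild (a : ℕ) : d (x ++ [a]) = 0 := not_not.1 (hx.2 a)
    have hsum := (hd x).hasSum h
    simp only [hchild, mul_zero] at hsum
    exact hx.1 (hsum.unique hasSum_zero)
  hasSum x hl := by
    by_cases hx : d x = 0
    · have hchild (a : ℕ) : d (x ++ [a]) = 0 := congrFun ((hd x).eq_zero_of_eq_zero hp hx) a
      simpa only [hchild, hx, mul_zero] using hasSum_zero
    · exact (hd x).hasSum fun h => hl ⟨hx, fun a ha => ha (congrFun ((hd x).eq_zero h) a)⟩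

end Caterpillar

section Regraft

variable {p : ℝ} {d : List ℕ → ℝ≥0} {cut : Set (List ℕ)}

lemma regraft_nil : regraft p d cut [] = d [] := by simp [regraft]

lemma regraft_concat_of_mem {x : List ℕ} (hx : x ∈ cut) (a : ℕ) :
    regraft p d cut (x ++ [a]) = caterpillarChild p (regraft p d cut x) a := by
  simp [regraft, hx]

lemma regraft_concat_of_notMem {x : List ℕ} (hx : x ∉ cut) (a : ℕ) :
    regraft p d cut (x ++ [a]) = d (x ++ [a]) := by
  simp [regraft, hx]

lemma regraft_le_one (hd : ∀ x, d x ≤ 1) (x : List ℕ) : regraft p d cut x ≤ 1 := by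
  cases x using List.reverseRecOn with
  | nil => exact regraft_nil.trans_le (hd [])
  | append_singleton x a =>
    by_cases h : x ∈ cut
    · exact (regraft_concat_of_mem h a).trans_le (min_le_left _ _)
    · exact (regraft_concat_of_notMem h a).trans_le (hd _)

variable (hcut : ∀ x ∈ cut, ∀ a, x ++ [a] ∈ cut)
include hcut

lemma regraft_of_notMem {x : List ℕ} (hx : x ∉ cut) : regraft p d cut x = d x := by
  cases x using List.reverseRecOn with
  | nil => exact regraft_nil
  | append_singleton x a => exact regraft_concat_of_notMem (fun h => hx (hcut x h a)) a

lemma isSplitting_regraft (hp : 1 < p) (hd : T.IsCapacityProfile p d) (x : List ℕ) :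
    IsSplitting p (regraft p d cut x) fun a => regraft p d cut (x ++ [a]) := by
  by_cases hx : x ∈ cut
  · simp only [regraft_concat_of_mem hx]
    exact isSplitting_caterpillarChild hp (regraft_le_one (hd.le_one hp) x)
  · simp only [regraft_concat_of_notMem hx, regraft_of_notMem hcut hx]
    exact hd.isSplitting hp x

lemma tendsto_residual_regraft (hp : 1 < p) {s : ℕ → List ℕ}
    (hs : ∀ n, ∃ a : ℕ, s (n + 1) = s n ++ [a]) (hpos : ∀ n, regraft p d cut (s n) ≠ 0) {n : ℕ}
    (hn : s n ∈ cut) : Tendsto (fun k => residual p (regraft p d cut) (s k)) atTop (𝓝 0) := by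
  choose a ha using hs
  have hmem (k : ℕ) (hk : n ≤ k) : s k ∈ cut := by
    induction k, hk using Nat.le_induction with
    | base => exact hn
    | succ k _ ih => exact ha k ▸ hcut _ ih (a k)
  have hstep : ∀ᶠ k in atTop, 2 < (regraft p d cut (s k) ^ (p - 1)⁻¹)⁻¹ →
      (regraft p d cut (s (k + 1)) ^ (p - 1)⁻¹)⁻¹ + 1 ≤ (regraft p d cut (s k) ^ (p - 1)⁻¹)⁻¹ := by
    filter_upwards [eventually_ge_atTop n] with k hk h2
    have hchild := regraft_concat_of_mem (p := p) (d := d) (hmem k hk) (a k)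
    rw [← ha] at hchild
    rw [hchild]
    exact (resistance_caterpillarChild hp h2 (hchild ▸ hpos (k + 1))).le
  have hresidual (k : ℕ) : residual p (regraft p d cut) (s (k + 1)) =
      residual p (regraft p d cut) (s k) * residualRatio p (regraft p d cut (s k)) :=
    ha k ▸ residual_concat (s k) (a k)
  refine tendsto_zero_of_frequently_succ_le_mul (c := 2⁻¹) (antitone_nat_of_succ_le fun k => ?_)
    (by norm_num) ((frequently_le_of_succ_add_one_le hstep).mono fun k hk => ?_)
  · exact (hresidual k).trans_le (mul_le_of_le_one_right' (residualRatio_le_one _))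
  · rw [hresidual, mul_comm]
    gcongr
    rw [residualRatio, tsub_le_iff_right]
    have hinv : 2⁻¹ ≤ regraft p d cut (s k) ^ (p - 1)⁻¹ :=
      inv_le_of_inv_le₀ (NNReal.rpow_pos (pos_iff_ne_zero.2 (hpos k))) hk
    calc (1 : ℝ≥0) = 2⁻¹ + 2⁻¹ := by rw [← two_mul, mul_inv_cancel₀ two_ne_zero]
      _ ≤ _ := by gcongr

lemma equilibriumFun_regraft {x : List ℕ} (hx : ∀ y, y <+: x → y ∉ cut) :
    equilibriumFun p (regraft p d cut) x = equilibriumFun p d x := by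
  have hresidual : residual p (regraft p d cut) x = residual p d x :=
    Finset.prod_congr rfl fun y hy => by
      rw [regraft_of_notMem hcut (hx y (mem_prefixes.1 (Finset.mem_of_mem_erase hy)))]
  rw [equilibriumFun, equilibriumFun, hresidual, regraft_of_notMem hcut (hx x List.prefix_rfl)]

lemma one_le_potential_regraft (hp : 1 < p) (hd : T.IsCapacityProfile p d)
    (hS : S.IsCapacityProfile p (regraft p d cut))
    (hmem : ∀ x, x ∈ S.carrier ↔ regraft p d cut x ≠ 0)
    (hreg : ∀ ξ : T.Boundary, (∀ x ∈ ξ.1, x ∉ cut) →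
      1 ≤ T.potential (T.restrict (equilibriumFun p d)) ξ) (ζ : S.Boundary) :
    1 ≤ S.potential (S.restrict (equilibriumFun p (regraft p d cut))) ζ := by
  rcases ζ.2 with ⟨s, h0, hs, hsS, hζ⟩ | ⟨x, hx, hζ⟩
  · by_cases hc : ∃ n, s n ∈ cut
    · obtain ⟨n, hn⟩ := hc
      exact hS.one_le_potential_of_tendsto hp (fun k => hζ ▸ Set.mem_range_self k)
        (tendsto_residual_regraft hcut hp hs (fun k => (hmem _).1 (hsS k)) hn)
    · push Not at hc
      have hζc : ∀ x ∈ ζ.1, x ∉ cut := by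
        rw [hζ]
        rintro _ ⟨n, rfl⟩
        exact hc n
      have hsT (n : ℕ) : s n ∈ T.carrier := by
        by_contra h
        exact (hmem _).1 (hsS n) ((regraft_of_notMem hcut (hc n)).trans (hd.eq_zero _ h))
      exact (hreg ⟨ζ.1, Or.inl ⟨s, h0, hs, hsT, hζ⟩⟩ hζc).trans_eq <|
        potential_restrict_congr rfl fun x hx => (equilibriumFun_regraft hcut fun y hy =>
          hζc y (ζ.isMaximalPath.mem_of_prefix _ _ hx hy)).symm
  · exact hS.one_le_potential_of_eq_one hp (hζ ▸ List.prefix_rfl : x ∈ ζ.1) (hS.eq_one x hx)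

lemma isBoundaryPoint_of_forall_notMem (hd : T.IsCapacityProfile p d)
    (hmem : ∀ x, x ∈ S.carrier ↔ regraft p d cut x ≠ 0) {ζ : T.Boundary}
    (hζ : ∀ x ∈ ζ.1, x ∉ cut ∧ d x ≠ 0) : S.IsBoundaryPoint ζ.1 := by
  have hζS (x : List ℕ) (hx : x ∈ ζ.1) : x ∈ S.carrier := by
    rw [hmem, regraft_of_notMem hcut (hζ x hx).1]
    exact (hζ x hx).2
  refine isBoundaryPoint_iff_isMaximalPath.2 (ζ.isMaximalPath.of_isLeaf hζS fun x hx hl =>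
    ⟨hζS x hx, fun a ha => (hmem _).1 ha ?_⟩)
  rw [regraft_concat_of_notMem (hζ x hx).1, hd.eq_zero _ (hl.2 a)]

end Regraft

/-! ### Approximation by regular boundaries -/

section Approximation

variable {p : ℝ} {d : List ℕ → ℝ≥0}

lemma IsCapacityProfile.exists_hasRegularBoundary (hd : T.IsCapacityProfile p d) (hp : 1 < p)
    (h0 : d [] ≠ 0) {U : Set T.Boundary} (hU : IsOpen U)
    (hreg : ∀ ζ ∉ U, 1 ≤ T.potential (T.restrict (equilibriumFun p d)) ζ)
    (hpos : ∀ ζ ∉ U, ∀ x ∈ ζ.1, 0 < d x) :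
    ∃ R : LocallyFiniteTree, R.HasRegularBoundary p ∧ R.boundaryCapacity p = d [] ∧
      ∀ ζ ∉ U, R.IsBoundaryPoint ζ.1 := by
  let cut : Set (List ℕ) := {x | T.tent x ⊆ U}
  have hcut (x : List ℕ) (hx : x ∈ cut) (a : ℕ) : x ++ [a] ∈ cut := fun ζ hζ =>
    hx (ζ.isMaximalPath.mem_of_prefix _ _ hζ (List.prefix_append x [a]))
  have hmem (x : List ℕ) : x ∈ (supportTree hp (regraft_nil.trans_ne h0)
    (isSplitting_regraft hcut hp hd)).carrier ↔ regraft p d cut x ≠ 0 := Iff.rfl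
  have hR := isCapacityProfile_supportTree hp (regraft_nil.trans_ne h0)
    (isSplitting_regraft hcut hp hd)
  obtain ⟨hregular, hcap⟩ := hR.hasRegularBoundary hp <|
    one_le_potential_regraft hcut hp hd hR hmem fun ζ hζ => hreg ζ fun hζU => by
      obtain ⟨x, hx, hxU⟩ := exists_tent_subset hU hζU
      exact hζ x hx hxU
  exact ⟨_, hregular, hcap.trans (by rw [regraft_nil]), fun ζ hζ =>
    isBoundaryPoint_of_forall_notMem hcut hd hmem fun x hx =>
      ⟨fun h => hζ (h hx), (hpos ζ hζ x hx).ne'⟩⟩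

lemma capacity_le_capacity_commonBoundary (hp : 0 < p) {A : Set T.Boundary}
    (h : ∀ ζ ∈ A, S.IsBoundaryPoint ζ.1) :
    T.capacity p A ≤ (T.commonSubtree S).capacity p (T.commonBoundary S) :=
  capacity_le_capacity hp fun ζ hζ => ⟨⟨ζ.1, ζ.2.commonSubtree (h ζ hζ)⟩, ⟨ζ.2, h ζ hζ⟩, rfl⟩

lemma exists_hasRegularBoundary_le_capacity_commonBoundary (hp : 1 < p)
    (hT : 0 < T.boundaryCapacity p) {ε : ℝ≥0∞} (hε : 0 < ε) :
    ∃ R : LocallyFiniteTree, R.HasRegularBoundary p ∧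
      R.boundaryCapacity p = T.boundaryCapacity p ∧
      T.boundaryCapacity p - ε ≤ (T.commonSubtree R).capacity p (T.commonBoundary R) := by
  have hd := isCapacityProfile_tentCapacity (T := T) hp
  have hmass : hd.isFlow.measure Set.univ = T.boundaryCapacity p :=
    hd.measure_univ.trans (boundaryCapacity_eq hp).symm
  have hgood : ∀ᵐ ζ ∂hd.isFlow.measure,
      1 ≤ T.potential (T.restrict (equilibriumFun p (T.tentCapacity p))) ζ ∧
        ∀ x ∈ ζ.1, 0 < T.tentCapacity p x := by
    rw [← hd.copotentialPow_measure hp]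
    exact (ae_one_le_potential_copotentialPow hp (hd.measure_potential_le_one hp) hmass).and
      hd.ae_forall_pos
  obtain ⟨U, hbad, hU, hμU⟩ := Set.exists_isOpen_lt_of_lt _ (ε / ENNReal.ofReal p)
    ((ae_iff.1 hgood).trans_lt (ENNReal.div_pos hε.ne' ENNReal.ofReal_ne_top))
  have hcompl (ζ : T.Boundary) (hζ : ζ ∉ U) := not_not.1 fun h => hζ (hbad h)
  obtain ⟨R, hregular, hcap, hR⟩ := hd.exists_hasRegularBoundary hp
    (fun h => hT.ne' (by rw [boundaryCapacity_eq hp, h, ENNReal.coe_zero])) hU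
    (fun ζ hζ => (hcompl ζ hζ).1) fun ζ hζ => (hcompl ζ hζ).2
  refine ⟨R, hregular, hcap.trans (boundaryCapacity_eq hp).symm, tsub_le_iff_right.2 ?_⟩
  calc T.boundaryCapacity p ≤ T.capacity p Uᶜ + ε := hmass ▸ measure_univ_le_capacity_add hp
        (hd.measure_potential_le_one hp) (by rw [compl_compl]; exact hμU.le)
    _ ≤ (T.commonSubtree R).capacity p (T.commonBoundary R) + ε := by
      gcongr
      exact capacity_le_capacity_commonBoundary (zero_lt_one.trans hp) hR

end Approximation
end

end LocallyFiniteTree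

theorem mainTheorem4 (p : ℝ) (hp : 1 < p) (T : LocallyFiniteTree) (hT : 0 < T.boundaryCapacity p) :
    (∃ R : LocallyFiniteTree, R.HasRegularBoundary p ∧
      R.boundaryCapacity p = T.boundaryCapacity p) ∧
    ∀ ε : ℝ, 0 < ε → ∃ R : LocallyFiniteTree, R.HasRegularBoundary p ∧
      R.boundaryCapacity p = T.boundaryCapacity p ∧
      T.boundaryCapacity p - ENNReal.ofReal ε ≤ (T.commonSubtree R).boundaryCapacity p ∧
      T.boundaryCapacity p - ENNReal.ofReal ε ≤
        (T.commonSubtree R).capacity p (T.commonBoundary R) := by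
  have happrox (ε : ℝ) (hε : 0 < ε) :=
    LocallyFiniteTree.exists_hasRegularBoundary_le_capacity_commonBoundary hp hT
      (ENNReal.ofReal_pos.2 hε)
  constructor
  · obtain ⟨R, hregular, hcap, -⟩ := happrox 1 one_pos
    exact ⟨R, hregular, hcap⟩
  · intro ε hε
    obtain ⟨R, hregular, hcap, hle⟩ := happrox ε hε
    have hsub : (T.commonSubtree R).capacity p (T.commonBoundary R) ≤
        (T.commonSubtree R).boundaryCapacity p :=
      LocallyFiniteTree.capacity_le_capacity (zero_lt_one.trans hp) fun ζ _ => ⟨ζ, trivial, rfl⟩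
    exact ⟨R, hregular, hcap, hle.trans hsub, hle⟩
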